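/- Let $k$ be a field, let $n\ge 0$, let $S=k[x_1,\ldots,x_n]$, and let $M\subsetneq S$ be a proper monomial ideal (an ideal generated by monomials) that is Artinian, i.e. such that $S/M$ is an Artinian ring. Then the projective dimension of the $S$-module $S/M$ is equal to the number of variables: $\operatorname{pd}_S(S/M)=n$. -/

import Mathlib

/-- An ideal of a polynomial ring is a *monomial ideal* if it is generated by a set of monomials
`x ^ a`, `a ∈ A`. -/
def IsMonomialIdeal {σ k : Type*} [CommSemiring k] (M : Ideal (MvPolynomial σ k)) : Prop :=
  ∃ A : Set (σ →₀ ℕ), M = Ideal.span ((fun a => MvPolynomial.monomial a (1 : k)) '' A)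

open CategoryTheory Abelian Pointwise

/-! The Artinian condition puts a power of each variable in `M`, so `S/M` has finite length and all
its composition factors are `K = S/(x_1, …, x_n)`. Killing the variables one at a time, each regular
on the previous quotient, gives `pd K ≤ n` and `Ext^n(K, K) ≠ 0`. The upper bound passes to `S/M`
along a composition series. For the lower bound, take a copy of `K` inside `S/M`: if `pd (S/M) < n`,
then `pd ((S/M)/K) ≤ n` forces `pd K < n`, contradicting `Ext^n(K, K) ≠ 0`. -/

theorem CategoryTheory.Abelian.Ext.nontrivial_of_iso {C : Type*} [Category* C] [Abelian C]
    [HasExt C] {X Y : C} (e : X ≅ Y) (L : C) (i : ℕ) [Nontrivial (Ext X L i)] :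
    Nontrivial (Ext Y L i) := by
  refine Function.Injective.nontrivial (α := Ext X L i)
    (f := fun y => (Ext.mk₀ e.inv).comp y (zero_add i)) fun y z h => ?_
  have h' := congrArg (fun y => (Ext.mk₀ e.hom).comp y (zero_add i)) h
  simpa [Ext.mk₀_comp_mk₀_assoc] using h'

section RegularQuotient

universe u

variable {R : Type u} [CommRing R]

/-- If `x` is regular on `N` and kills `L`, the connecting map `Ext N L i → Ext (N / x N) L (i + 1)`
is injective. -/
theorem nontrivial_ext_quotSMulTop {N L : ModuleCat.{u} R} {x : R} (reg : IsSMulRegular N x)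
    (hL : ∀ z : L, x • z = 0) (i : ℕ) [Nontrivial (Ext N L i)] :
    Nontrivial (Ext (ModuleCat.of R (QuotSMulTop x N)) L (i + 1)) := by
  obtain ⟨e, he⟩ := exists_ne (0 : Ext N L i)
  have hS := reg.smulShortComplex_shortExact
  refine ⟨⟨hS.extClass.comp e (add_comm 1 i), 0, fun h => he ?_⟩⟩
  -- By exactness a class killed by the connecting map is `x` times some `e'`, and `x` acts as zero
  -- on `Ext N L i` because it does on `L`.
  obtain ⟨e', he'⟩ := Ext.contravariant_sequence_exact₁ hS L e (add_comm 1 i) h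
  have hx : x • 𝟙 L = 0 := by
    ext z
    exact hL z
  have h1 : x • e' = 0 := by
    rw [Ext.smul_eq_comp_mk₀, hx, Ext.mk₀_zero, Ext.comp_zero]
  have h2 (y : Ext N L i) (hy : x • y = 0) :
      (Ext.mk₀ (x • 𝟙 N)).comp y (zero_add i) = 0 := by
    rw [Ext.mk₀_smul, Ext.smul_comp, Ext.mk₀_id_comp, hy]
  exact he'.symm.trans (h2 e' h1)

theorem hasProjectiveDimensionLT_quotSMulTop {N : ModuleCat.{u} R} {x : R}
    (reg : IsSMulRegular N x) (i : ℕ) [HasProjectiveDimensionLT N i] :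
    HasProjectiveDimensionLT (ModuleCat.of R (QuotSMulTop x N)) (i + 1) :=
  reg.smulShortComplex_shortExact.hasProjectiveDimensionLT_X₃ i ‹_›
    (hasProjectiveDimensionLT_of_ge N i (i + 1) i.le_succ)

/-- Killing a further element `x` in `R / I` gives `R / (I + (x))`. -/
noncomputable def quotSMulTopQuotientEquiv (I : Ideal R) (x : R) :
    QuotSMulTop x (R ⧸ I) ≃ₗ[R] R ⧸ (I ⊔ Ideal.span {x}) :=
  (Submodule.quotEquivOfEq _ _ (by
    rw [← Submodule.ideal_span_singleton_smul, Submodule.map_span, Set.image_singleton,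
      ← Ideal.submodule_span_eq, ← LinearMap.range_eq_top.2 I.mkQ_surjective,
      LinearMap.range_eq_map, ← Submodule.map_smul'', smul_eq_mul, Ideal.mul_top,
      Ideal.submodule_span_eq, Ideal.span, Submodule.map_span, Set.image_singleton])).trans
    (Submodule.quotientQuotientEquivQuotientSup I (Ideal.span {x}))

end RegularQuotient

namespace MvPolynomial

universe u v

variable {k : Type u} [Field k] {σ : Type v}

/-- Membership in the ideal is tested on exponents at indices in `s`, and multiplying by `X i`
changes only the exponent at `i ∉ s`. -/
theorem isSMulRegular_X_quotient_span_X_image {s : Set σ} {i : σ} (hi : i ∉ s) :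
    IsSMulRegular (MvPolynomial σ k ⧸ Ideal.span (X '' s : Set (MvPolynomial σ k)))
      (X i : MvPolynomial σ k) := by
  rw [isSMulRegular_iff_right_eq_zero_of_smul]
  intro q
  obtain ⟨p, rfl⟩ := Ideal.Quotient.mk_surjective q
  intro h
  rw [← Ideal.Quotient.mk_eq_mk, ← Submodule.Quotient.mk_smul, Ideal.Quotient.mk_eq_mk,
    Ideal.Quotient.eq_zero_iff_mem, mem_ideal_span_X_image] at h
  rw [Ideal.Quotient.eq_zero_iff_mem, mem_ideal_span_X_image]
  intro m hm
  obtain ⟨j, hj, hmj⟩ := h (Finsupp.single i 1 + m) (by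
    rw [mem_support_iff, smul_eq_mul, coeff_X_mul]
    exact mem_support_iff.1 hm)
  have hij : i ≠ j := fun h => hi (h ▸ hj)
  exact ⟨j, hj, by simpa [Finsupp.single_apply, hij] using hmj⟩

/-- The ideal generated by all the variables is maximal. -/
theorem isMaximal_span_range_X : (Ideal.span (Set.range X : Set (MvPolynomial σ k))).IsMaximal := by
  have h : Ideal.span (Set.range X : Set (MvPolynomial σ k)) =
      RingHom.ker (constantCoeff (R := k) (σ := σ)) := by
    rw [← Set.image_univ]
    ext p
    rw [mem_ideal_span_X_image, RingHom.mem_ker, constantCoeff_eq]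
    constructor
    · intro h
      by_contra h0
      obtain ⟨j, -, hj⟩ := h 0 (mem_support_iff.2 h0)
      exact hj rfl
    · intro h m hm
      by_contra! hc
      have : m = 0 := Finsupp.ext fun j => hc j (Set.mem_univ j)
      exact mem_support_iff.1 hm (this ▸ h)
  rw [h]
  exact RingHom.ker_isMaximal_of_surjective _ fun a => ⟨C a, constantCoeff_C σ a⟩

theorem exists_X_pow_mem_of_isMonomialIdeal {M : Ideal (MvPolynomial σ k)}
    (hmon : IsMonomialIdeal M) (hart : IsArtinianRing (MvPolynomial σ k ⧸ M)) (i : σ) :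
    ∃ a : ℕ, (X i : MvPolynomial σ k) ^ a ∈ M := by
  classical
  obtain ⟨a, y, hy⟩ := IsArtinian.exists_pow_succ_smul_dvd
    (Ideal.Quotient.mk M (X i)) (1 : MvPolynomial σ k ⧸ M)
  obtain ⟨q, rfl⟩ := Ideal.Quotient.mk_surjective y
  refine ⟨a, ?_⟩
  obtain ⟨A, rfl⟩ := hmon
  rw [smul_eq_mul, smul_eq_mul, mul_one, ← map_pow, ← map_pow, ← map_mul, eq_comm,
    Ideal.Quotient.eq, mem_ideal_span_monomial_image] at hy
  -- The monomial `X i ^ a` survives in `X i ^ (a + 1) * q - X i ^ a`, since every term of the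
  -- product has larger degree in `X i`. A monomial ideal contains each monomial of its elements.
  obtain ⟨b, hb, hba⟩ := hy (Finsupp.single i a) (by
    rw [mem_support_iff, coeff_sub, X_pow_eq_monomial, X_pow_eq_monomial, coeff_monomial, if_pos rfl,
      coeff_monomial_mul', if_neg]
    · simp
    · intro h
      simpa using h i)
  rw [mem_ideal_span_monomial_image]
  intro c hc
  rw [X_pow_eq_monomial] at hc
  rw [Finset.mem_singleton.1 (support_monomial_subset hc)]
  exact ⟨b, hb, hba⟩

/-- A simple module on which all variables act nilpotently is the residue field at the origin. -/
theorem nonempty_linearEquiv_of_isSimpleModule {N : Type*} [AddCommGroup N]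
    [Module (MvPolynomial σ k) N] [IsSimpleModule (MvPolynomial σ k) N]
    (hN : ∀ i : σ, ∃ a : ℕ, ∀ z : N, (X i : MvPolynomial σ k) ^ a • z = 0) :
    Nonempty (N ≃ₗ[MvPolynomial σ k]
      MvPolynomial σ k ⧸ Ideal.span (Set.range X : Set (MvPolynomial σ k))) := by
  obtain ⟨J, hJ, ⟨e⟩⟩ := isSimpleModule_iff_quot_maximal.mp ‹IsSimpleModule (MvPolynomial σ k) N›
  have hle : Ideal.span (Set.range X : Set (MvPolynomial σ k)) ≤ J := by
    rw [Ideal.span_le]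
    rintro _ ⟨i, rfl⟩
    obtain ⟨a, ha⟩ := hN i
    refine hJ.isPrime.mem_of_pow_mem a ?_
    have h := congrArg e (ha (e.symm (Ideal.Quotient.mk J 1)))
    rw [map_smul, e.apply_symm_apply, map_zero, ← Ideal.Quotient.mk_eq_mk,
      ← Submodule.Quotient.mk_smul, Ideal.Quotient.mk_eq_mk, Ideal.Quotient.eq_zero_iff_mem,
      smul_eq_mul, mul_one] at h
    exact h
  exact ⟨e.trans (Submodule.quotEquivOfEq _ _
    (isMaximal_span_range_X.eq_of_le hJ.ne_top hle).symm)⟩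

/-- Each new variable is regular on the current quotient and kills `L`, so it raises both the
dimension bound and the degree of a nonzero Ext by one. The start is `Hom(S, L) ≅ L ≠ 0`. -/
theorem hasProjectiveDimensionLE_and_nontrivial_ext_quotient_span_X_image (s : Finset σ)
    {L : ModuleCat.{max u v} (MvPolynomial σ k)} [Nontrivial L]
    (hL : ∀ (i : σ) (z : L), (X i : MvPolynomial σ k) • z = 0) :
    HasProjectiveDimensionLE (ModuleCat.of (MvPolynomial σ k)
      (MvPolynomial σ k ⧸ Ideal.span (X '' (s : Set σ) : Set (MvPolynomial σ k)))) s.card ∧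
    Nontrivial (Ext (ModuleCat.of (MvPolynomial σ k)
      (MvPolynomial σ k ⧸ Ideal.span (X '' (s : Set σ) : Set (MvPolynomial σ k)))) L s.card) := by
  classical
  induction s using Finset.induction_on with
  | empty =>
    let e : (MvPolynomial σ k ⧸ Ideal.span (X '' ((∅ : Finset σ) : Set σ) :
        Set (MvPolynomial σ k))) ≃ₗ[MvPolynomial σ k] MvPolynomial σ k :=
      Submodule.quotEquivOfEqBot _ (by simp)
    constructor
    · have : Module.Projective (MvPolynomial σ k) (MvPolynomial σ k ⧸
        Ideal.span (X '' ((∅ : Finset σ) : Set σ) : Set (MvPolynomial σ k))) := .of_equiv e.symm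
      rw [Finset.card_empty, ← projective_iff_hasProjectiveDimensionLE_zero,
        ← IsProjective.iff_projective]
      exact this
    · obtain ⟨z, hz⟩ := exists_ne (0 : L)
      refine Ext.homEquiv₀.nontrivial_congr.2
        ⟨⟨ModuleCat.ofHom (LinearMap.toSpanSingleton _ L z ∘ₗ e.toLinearMap), 0, fun h => hz ?_⟩⟩
      have h' := congrArg (fun f => f.hom (e.symm 1)) h
      simpa using h'
  | insert i s hi ih =>
    obtain ⟨h₁, h₂⟩ := ih
    have reg := isSMulRegular_X_quotient_span_X_image (k := k) (s := (s : Set σ)) hi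
    let e := (quotSMulTopQuotientEquiv (Ideal.span (X '' (s : Set σ))) (X i)).trans
      (Submodule.quotEquivOfEq _
        (Ideal.span (X '' ((insert i s : Finset σ) : Set σ) : Set (MvPolynomial σ k))) (by
        rw [Finset.coe_insert, Set.image_insert_eq, Ideal.span_insert, sup_comm]))
    rw [Finset.card_insert_of_notMem hi]
    constructor
    · have := hasProjectiveDimensionLT_quotSMulTop (N := ModuleCat.of _ _) reg (s.card + 1)
      exact hasProjectiveDimensionLT_of_iso e.toModuleIso _
    · have := nontrivial_ext_quotSMulTop (N := ModuleCat.of _ _) (L := L) reg (hL i) s.card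
      exact Ext.nontrivial_of_iso e.toModuleIso L _

theorem X_smul_quotient_span_range_X (i : σ)
    (z : MvPolynomial σ k ⧸ Ideal.span (Set.range X : Set (MvPolynomial σ k))) :
    (X i : MvPolynomial σ k) • z = 0 := by
  obtain ⟨p, rfl⟩ := Ideal.Quotient.mk_surjective z
  exact Ideal.Quotient.eq_zero_iff_mem.2
    (Ideal.mul_mem_right p _ (Ideal.subset_span ⟨i, rfl⟩))

theorem hasProjectiveDimensionLE_and_nontrivial_ext_quotient_span_range_X [Fintype σ] :
    HasProjectiveDimensionLE (ModuleCat.of (MvPolynomial σ k)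
      (MvPolynomial σ k ⧸ Ideal.span (Set.range X : Set (MvPolynomial σ k)))) (Fintype.card σ) ∧
    Nontrivial (Ext
      (ModuleCat.of (MvPolynomial σ k)
        (MvPolynomial σ k ⧸ Ideal.span (Set.range X : Set (MvPolynomial σ k))))
      (ModuleCat.of (MvPolynomial σ k)
        (MvPolynomial σ k ⧸ Ideal.span (Set.range X : Set (MvPolynomial σ k))))
      (Fintype.card σ)) := by
  have : Nontrivial (MvPolynomial σ k ⧸ Ideal.span (Set.range X : Set (MvPolynomial σ k))) :=
    Ideal.Quotient.nontrivial_iff.2 isMaximal_span_range_X.ne_top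
  have h := hasProjectiveDimensionLE_and_nontrivial_ext_quotient_span_X_image (k := k)
    (Finset.univ : Finset σ) (L := ModuleCat.of (MvPolynomial σ k)
      (MvPolynomial σ k ⧸ Ideal.span (Set.range X : Set (MvPolynomial σ k))))
    X_smul_quotient_span_range_X
  rwa [Finset.coe_univ, Set.image_univ, Finset.card_univ] at h

/-- A module of finite length on which every variable acts nilpotently has projective dimension
at most the number of variables. -/
theorem hasProjectiveDimensionLE_of_isFiniteLength [Fintype σ] {N : Type max u v} [AddCommGroup N]
    [Module (MvPolynomial σ k) N] (hfl : IsFiniteLength (MvPolynomial σ k) N)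
    (hN : ∀ i : σ, ∃ a : ℕ, ∀ z : N, (X i : MvPolynomial σ k) ^ a • z = 0) :
    HasProjectiveDimensionLE (ModuleCat.of (MvPolynomial σ k) N) (Fintype.card σ) := by
  induction hfl with
  | @of_subsingleton N _ _ _ =>
    have := (ModuleCat.isZero_of_subsingleton
      (ModuleCat.of (MvPolynomial σ k) N)).hasProjectiveDimensionLT_zero
    exact hasProjectiveDimensionLT_of_ge _ 0 _ (Nat.zero_le _)
  | @of_simple_quotient N _ _ P _ hP ih =>
    have hS := LinearMap.shortExact_shortComplexKer P.mkQ_surjective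
    refine hS.hasProjectiveDimensionLT_X₂ _ ?_ ?_
    · have := ih fun i => (hN i).imp fun a ha z => Subtype.ext (ha z)
      exact hasProjectiveDimensionLT_of_iso
        (LinearEquiv.ofEq _ _ P.ker_mkQ.symm).toModuleIso _
    · obtain ⟨e⟩ := nonempty_linearEquiv_of_isSimpleModule (k := k) (σ := σ) (N := N ⧸ P)
        fun i => (hN i).imp fun a ha z => by
          obtain ⟨z, rfl⟩ := P.mkQ_surjective z
          rw [← map_smul, ha, map_zero]
      have := (hasProjectiveDimensionLE_and_nontrivial_ext_quotient_span_range_X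
        (k := k) (σ := σ)).1
      exact hasProjectiveDimensionLT_of_iso e.symm.toModuleIso _

/-- A nonzero module of finite length on which every variable acts nilpotently has projective
dimension equal to the number of variables. -/
theorem projectiveDimension_eq_card_of_isFiniteLength [Fintype σ] {N : Type max u v}
    [AddCommGroup N] [Module (MvPolynomial σ k) N] [Nontrivial N]
    (hfl : IsFiniteLength (MvPolynomial σ k) N)
    (hN : ∀ i : σ, ∃ a : ℕ, ∀ z : N, (X i : MvPolynomial σ k) ^ a • z = 0) :
    projectiveDimension (ModuleCat.of (MvPolynomial σ k) N) = (Fintype.card σ : WithBot ℕ∞) := by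
  refine le_antisymm ((projectiveDimension_le_iff _ _).2
    (hasProjectiveDimensionLE_of_isFiniteLength hfl hN))
    ((projectiveDimension_ge_iff _ _).2 fun hlt => ?_)
  obtain ⟨-, _⟩ := isFiniteLength_iff_isNoetherian_isArtinian.1 hfl
  obtain ⟨P, hP⟩ := IsAtomic.exists_atom (Submodule (MvPolynomial σ k) N)
  have : IsSimpleModule (MvPolynomial σ k) P := isSimpleModule_iff_isAtom.2 hP
  obtain ⟨e⟩ := nonempty_linearEquiv_of_isSimpleModule (k := k) (σ := σ) (N := P)
    fun i => (hN i).imp fun a ha z => Subtype.ext (ha z)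
  have hQ : HasProjectiveDimensionLE (ModuleCat.of (MvPolynomial σ k) (N ⧸ P))
      (Fintype.card σ) :=
    hasProjectiveDimensionLE_of_isFiniteLength (hfl.of_surjective P.mkQ_surjective)
      fun i => (hN i).imp fun a ha z => by
        obtain ⟨z, rfl⟩ := P.mkQ_surjective z
        rw [← map_smul, ha, map_zero]
  have hS := LinearMap.shortExact_shortComplexKer P.mkQ_surjective
  -- The kernel of a surjection needs one degree less from the quotient: `pd N < n` and `pd (N/P) <
  -- n + 1` suffice for `pd P < n`.
  have hker := hS.hasProjectiveDimensionLT_X₁ (Fintype.card σ) hlt hQ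
  have hK := hasProjectiveDimensionLT_of_iso
    ((LinearEquiv.ofEq _ _ P.ker_mkQ).trans e).toModuleIso (Fintype.card σ)
  have hnt := (hasProjectiveDimensionLE_and_nontrivial_ext_quotient_span_range_X
    (k := k) (σ := σ)).2
  exact not_subsingleton_iff_nontrivial.2 hnt
    (HasProjectiveDimensionLT.subsingleton _ (Fintype.card σ) _ le_rfl _)

end MvPolynomial

theorem mainTheorem4 {k : Type*} [Field k] (n : ℕ) (M : Ideal (MvPolynomial (Fin n) k))
    (hmon : IsMonomialIdeal M) (hproper : M ≠ ⊤)
    (hart : IsArtinianRing (MvPolynomial (Fin n) k ⧸ M)) :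
    CategoryTheory.projectiveDimension
      (ModuleCat.of (MvPolynomial (Fin n) k) (MvPolynomial (Fin n) k ⧸ M)) = (n : WithBot ℕ∞) := by
  have : Nontrivial (MvPolynomial (Fin n) k ⧸ M) := Ideal.Quotient.nontrivial_iff.2 hproper
  have : IsArtinian (MvPolynomial (Fin n) k) (MvPolynomial (Fin n) k ⧸ M) :=
    isArtinian_of_surjective_algebraMap (Ideal.Quotient.mk_surjective (I := M))
  have h := MvPolynomial.projectiveDimension_eq_card_of_isFiniteLength
    (isFiniteLength_iff_isNoetherian_isArtinian.2
      ⟨(inferInstance : IsNoetherian (MvPolynomial (Fin n) k) (MvPolynomial (Fin n) k ⧸ M)), this⟩)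
    fun i => (MvPolynomial.exists_X_pow_mem_of_isMonomialIdeal hmon hart i).imp
      fun a ha z => by
        obtain ⟨p, rfl⟩ := Ideal.Quotient.mk_surjective z
        exact Ideal.Quotient.eq_zero_iff_mem.2 (M.mul_mem_right p ha)
  rwa [Fintype.card_fin] at h
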